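/- Theorem (Local Recovery implies an Area Law). Consider a system of $n$ qubits with Hamiltonian $H=\sum_{\gamma\in\Gamma} H_\gamma$, a finite sum of Hermitian terms, let $\beta\ge 0$ be the inverse temperature and let $\rho = e^{-\beta H}/\mathrm{Tr}[e^{-\beta H}]$ be the Gibbs state. Let $A\subseteq[n]$ be a region with complement $\bar A$, and let $\partial H$ be the sum of those terms $H_\gamma$ whose support (the set of qubits on which $H_\gamma$ acts nontrivially) meets both $A$ and $\bar A$. Let $\sigma$ be an $n$-qubit state with marginals $\sigma_A$, $\sigma_{\bar A}$, and suppose that there is a quantum channel (completely positive trace-preserving map) $\mathcal R$ on $n$ qubits with $$\big\|\mathcal R[\sigma_{\bar A}\otimes\sigma_A]-\sigma\big\|_1\le \epsilon_{\mathrm{Markov}}\qquad\text{and}\qquad \mathcal R[\rho]=\rho .$$ Then $$ I(A:\bar A)_\sigma \;\le\; 2\beta\,\|\partial H\| + 4\,\epsilon_{\mathrm{Markov}}\cdot\max\Big(\log\frac1{\epsilon_{\mathrm{Markov}}},\ \beta\|H\|,\ n\Big).$$ Here $I(A:\bar A)_\sigma=S(\sigma_A)+S(\sigma_{\bar A})-S(\sigma)$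 with $S(\sigma)=-\mathrm{Tr}[\sigma\log\sigma]$ and $\log$ the natural logarithm, $\|\cdot\|$ is the operator norm, $\|\cdot\|_1$ is the trace norm, and for $\epsilon_{\mathrm{Markov}}=0$ the last term is read as $0$. -/

import Mathlib

open scoped Matrix ComplexOrder MatrixOrder Matrix.Norms.L2Operator Kronecker CStarAlgebra

/-- Complex matrices indexed by the computational basis `Λ → {0, 1}` of the Hilbert space
`(ℂ²)^{⊗ Λ}` of qubits placed at the sites of `Λ`. The norm `‖·‖` on this type is the operator
norm for the Euclidean norm (scope `Matrix.Norms.L2Operator`), and `≤` is the positive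
semidefinite (Loewner) order (scope `MatrixOrder`). -/
abbrev QubitOp (Λ : Type*) : Type _ := Matrix (Λ → Fin 2) (Λ → Fin 2) ℂ

noncomputable section

/-- Density matrices: positive semidefinite of unit trace. -/
def IsQuantumState {Λ : Type*} [Fintype Λ] [DecidableEq Λ] (σ : QubitOp Λ) : Prop :=
  σ.PosSemidef ∧ σ.trace = 1

/-- A completely positive map `R` that satisfies this is a quantum channel (CPTP map). -/
def IsTracePreserving {Λ : Type*} [Fintype Λ] [DecidableEq Λ]
    (R : QubitOp Λ →CP QubitOp Λ) : Prop :=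
  ∀ X : QubitOp Λ, (R X).trace = X.trace

/-- The trace norm (Schatten 1-norm) `‖X‖₁ = Tr |X|`, where `|X| = √(X† X)`. -/
def traceNorm {Λ : Type*} [Fintype Λ] [DecidableEq Λ] (X : QubitOp Λ) : ℝ :=
  (CFC.abs X).trace.re

/-- The von Neumann entropy `S(σ) = -Tr[σ log σ]`, with the natural logarithm. The matrix
logarithm is taken through the functional calculus, with the value `0` on the kernel, so that
`0 log 0 = 0`. -/
def vonNeumannEntropy {Λ : Type*} [Fintype Λ] [DecidableEq Λ] (σ : QubitOp Λ) : ℝ :=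
  -(σ * CFC.log σ).trace.re

/-- The Gibbs state `e^{-βH} / Tr[e^{-βH}]`. -/
def gibbsState {Λ : Type*} [Fintype Λ] [DecidableEq Λ] (β : ℝ) (H : QubitOp Λ) : QubitOp Λ :=
  (NormedSpace.exp (-(β : ℂ) • H)).trace⁻¹ • NormedSpace.exp (-(β : ℂ) • H)

section Regions

variable {Λ : Type*} [Fintype Λ] [DecidableEq Λ]

/-- The basis configuration on all sites that is `x` on `A` and `z` on the complement of `A`. -/
def glue (A : Finset Λ) (x : A → Fin 2) (z : ↥(Aᶜ) → Fin 2) : Λ → Fin 2 :=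
  fun i => if h : i ∈ A then x ⟨i, h⟩ else z ⟨i, Finset.mem_compl.mpr h⟩

/-- The marginal (reduced state) `σ_A` of `σ` on the region `A`: the partial trace over the
complement of `A`. -/
def marginal (A : Finset Λ) (σ : QubitOp Λ) : QubitOp A :=
  Matrix.of fun x y => ∑ z : ↥(Aᶜ) → Fin 2, σ (glue A x z) (glue A y z)

/-- The operator `X ⊗ Y` on all sites, for `X` on `A` and `Y` on the complement of `A`. -/
def regionTensor (A : Finset Λ) (X : QubitOp A) (Y : QubitOp ↥(Aᶜ)) : QubitOp Λ :=
  (X ⊗ₖ Y).submatrix (fun x => (fun i => x i, fun i => x i)) (fun x => (fun i => x i, fun i => x i))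

/-- The mutual information `I(A : Aᶜ)_σ = S(σ_A) + S(σ_{Aᶜ}) - S(σ)`. -/
def mutualInformation (A : Finset Λ) (σ : QubitOp Λ) : ℝ :=
  vonNeumannEntropy (marginal A σ) + vonNeumannEntropy (marginal Aᶜ σ) - vonNeumannEntropy σ

/-- `O` acts as the identity on the qubit at site `i`, i.e. `O = 1_i ⊗ O'` with `O'` an operator
on the remaining sites. -/
def ActsTriviallyAt (O : QubitOp Λ) (i : Λ) : Prop :=
  ∃ O' : QubitOp ↥(({i} : Finset Λ)ᶜ), O = regionTensor {i} 1 O'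

/-- The support of an operator: the sites on which it acts nontrivially. -/
def opSupport (O : QubitOp Λ) : Set Λ := {i | ¬ ActsTriviallyAt O i}

/-- The support of `O` meets both `A` and its complement. -/
def CrossesCut (A : Finset Λ) (O : QubitOp Λ) : Prop :=
  (∃ i ∈ A, i ∈ opSupport O) ∧ ∃ j ∈ Aᶜ, j ∈ opSupport O

open Classical in
/-- The boundary Hamiltonian `∂H`: the sum of the terms of `H = ∑ γ, h γ` that are
simultaneously supported on `A` and on its complement. -/
def boundaryHamiltonian {Γ : Type*} [Fintype Γ] (A : Finset Λ) (h : Γ → QubitOp Λ) : QubitOp Λ :=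
  ∑ γ with CrossesCut A (h γ), h γ

end Regions

end

/-! Let `τ` be the product of the two marginals. Entropy is additive on products, so the mutual
information is `S(τ) - S(σ) = (S(τ) - S(R τ)) + (S(R τ) - S(σ))`. Up to an additive constant,
relative entropy to the Gibbs state is `β` times energy minus entropy. Since `R` fixes the Gibbs
state, data processing bounds the first bracket by `β` times the energy lost from `τ` to `R τ`
(`vonNeumannEntropy_sub_map_le`). That loss is measured through `σ`: `τ` and `σ` have equal
marginals on both sides of the cut, so only boundary terms distinguish their energies
(`trace_sum_mul_sub`), and `R τ` is close to `σ` in trace norm. The second bracket is a Fannes-type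
continuity estimate (`vonNeumannEntropy_sub_le`), and `fannes_error_le` collects the errors.

Data processing (`spectralRelEntropy_map_le`) is proved through the relative modular operator. Its
resolvent is the supremum of a quadratic form (`modularForm`), which decreases under a channel by a
Kadison–Schwarz inequality for the dual map. Integrating over the resolvent parameter produces the
logarithms.

Throughout, matrices are written in eigenbases: a trace of two non-commuting matrices becomes a
double sum of eigenvalue products, weighted by the doubly stochastic matrix `overlap`. -/

/-! ### Spectral decompositions and overlaps of eigenbases -/

section SpectralForm

variable {ι : Type*} [Fintype ι] [DecidableEq ι]

/-- The Hermitian matrix with eigenvalues `p` and eigenvectors the columns of the unitary `U`. -/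
noncomputable def spectralMatrix (U : Matrix.unitaryGroup ι ℂ) (p : ι → ℝ) : Matrix ι ι ℂ :=
  (U : Matrix ι ι ℂ) * Matrix.diagonal (fun i => (p i : ℂ)) * (U : Matrix ι ι ℂ)ᴴ

/-- The transition probabilities between two orthonormal bases. -/
noncomputable def overlap (U V : Matrix.unitaryGroup ι ℂ) (i j : ι) : ℝ :=
  Complex.normSq (((U : Matrix ι ι ℂ)ᴴ * (V : Matrix ι ι ℂ)) i j)

lemma unitaryGroup_conjTranspose_mul_self (U : Matrix.unitaryGroup ι ℂ) :
    (U : Matrix ι ι ℂ)ᴴ * (U : Matrix ι ι ℂ) = 1 :=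
  Unitary.coe_star_mul_self U

lemma unitaryGroup_mul_conjTranspose_self (U : Matrix.unitaryGroup ι ℂ) :
    (U : Matrix ι ι ℂ) * (U : Matrix ι ι ℂ)ᴴ = 1 :=
  Unitary.coe_mul_star_self U

lemma overlap_nonneg (U V : Matrix.unitaryGroup ι ℂ) (i j : ι) : 0 ≤ overlap U V i j :=
  Complex.normSq_nonneg _

lemma overlap_comm (U V : Matrix.unitaryGroup ι ℂ) (i j : ι) :
    overlap U V i j = overlap V U j i := by
  have : ((U : Matrix ι ι ℂ)ᴴ * (V : Matrix ι ι ℂ)) =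
      ((V : Matrix ι ι ℂ)ᴴ * (U : Matrix ι ι ℂ))ᴴ := by simp
  rw [overlap, overlap, this, Matrix.conjTranspose_apply, ← starRingEnd_apply,
    Complex.normSq_conj]

lemma overlap_self (U : Matrix.unitaryGroup ι ℂ) (i j : ι) :
    overlap U U i j = if i = j then 1 else 0 := by
  rw [overlap, unitaryGroup_conjTranspose_mul_self, Matrix.one_apply]
  split_ifs <;> simp

/-- Rows of the unitary `Uᴴ V` are unit vectors. With `sum_overlap'` this makes the overlaps doubly
stochastic, so termwise scalar inequalities sum to trace inequalities. -/
lemma sum_overlap (U V : Matrix.unitaryGroup ι ℂ) (i : ι) : ∑ j, overlap U V i j = 1 := by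
  set W := (U : Matrix ι ι ℂ)ᴴ * (V : Matrix ι ι ℂ) with hW
  have h : W * Wᴴ = 1 := by
    rw [hW, Matrix.conjTranspose_mul, Matrix.conjTranspose_conjTranspose, Matrix.mul_assoc,
      ← Matrix.mul_assoc (V : Matrix ι ι ℂ), unitaryGroup_mul_conjTranspose_self, Matrix.one_mul,
      unitaryGroup_conjTranspose_mul_self]
  have h2 := congrFun (congrFun h i) i
  rw [Matrix.mul_apply, Matrix.one_apply_eq] at h2
  have h3 := congrArg Complex.re h2
  simpa [overlap, Matrix.conjTranspose_apply, ← hW, Complex.normSq_apply] using h3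

lemma sum_overlap' (U V : Matrix.unitaryGroup ι ℂ) (j : ι) : ∑ i, overlap U V i j = 1 := by
  simp_rw [overlap_comm U V]
  exact sum_overlap V U j

lemma Matrix.IsHermitian.exists_eq_spectralMatrix {X : Matrix ι ι ℂ} (hX : X.IsHermitian) :
    X = spectralMatrix hX.eigenvectorUnitary hX.eigenvalues := by
  conv_lhs => rw [hX.spectral_theorem]
  rfl

lemma isHermitian_spectralMatrix (U : Matrix.unitaryGroup ι ℂ) (p : ι → ℝ) :
    (spectralMatrix U p).IsHermitian := by
  rw [Matrix.IsHermitian, spectralMatrix, Matrix.conjTranspose_mul, Matrix.conjTranspose_mul,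
    Matrix.conjTranspose_conjTranspose, Matrix.diagonal_conjTranspose, Matrix.mul_assoc]
  congr 3
  ext i
  simp

lemma trace_spectralMatrix (U : Matrix.unitaryGroup ι ℂ) (p : ι → ℝ) :
    (spectralMatrix U p).trace = ((∑ i, p i : ℝ) : ℂ) := by
  rw [spectralMatrix, Matrix.trace_mul_comm, ← Matrix.mul_assoc,
    unitaryGroup_conjTranspose_mul_self, Matrix.one_mul, Matrix.trace_diagonal]
  push_cast
  rfl

lemma trace_spectralMatrix_mul (U V : Matrix.unitaryGroup ι ℂ) (p q : ι → ℝ) :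
    (spectralMatrix U p * spectralMatrix V q).trace =
      ((∑ i, ∑ j, overlap U V i j * (p i * q j) : ℝ) : ℂ) := by
  have h : (spectralMatrix U p * spectralMatrix V q).trace =
      (Matrix.diagonal (fun i => (p i : ℂ)) * (((U : Matrix ι ι ℂ)ᴴ * (V : Matrix ι ι ℂ)) *
        (Matrix.diagonal (fun i => (q i : ℂ)) *
          ((U : Matrix ι ι ℂ)ᴴ * (V : Matrix ι ι ℂ))ᴴ))).trace := by
    simp only [spectralMatrix]
    rw [Matrix.mul_assoc, Matrix.mul_assoc, Matrix.trace_mul_comm]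
    simp only [Matrix.conjTranspose_mul, Matrix.conjTranspose_conjTranspose, Matrix.mul_assoc]
  rw [h, Matrix.trace]
  push_cast
  refine Finset.sum_congr rfl fun i _ => ?_
  rw [Matrix.diag_apply, Matrix.diagonal_mul, Matrix.mul_apply, Finset.mul_sum]
  refine Finset.sum_congr rfl fun j _ => ?_
  rw [Matrix.diagonal_mul, Matrix.conjTranspose_apply, overlap, Complex.normSq_eq_conj_mul_self]
  simp only [RCLike.star_def]
  ring

/-- The functional calculus is known in one chosen eigenbasis `V`, with eigenvalues `q`. The unitary
`Vᴴ U` intertwines the two diagonals, so its `(i, j)` entry vanishes unless `q i = p j`; hence it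
also intertwines their images under `f`. -/
lemma cfc_spectralMatrix (U : Matrix.unitaryGroup ι ℂ) (p : ι → ℝ) (f : ℝ → ℝ) :
    cfc f (spectralMatrix U p) = spectralMatrix U (fun i => f (p i)) := by
  have hX := isHermitian_spectralMatrix U p
  set V := hX.eigenvectorUnitary
  set q := hX.eigenvalues
  have hV : spectralMatrix U p = spectralMatrix V q := hX.exists_eq_spectralMatrix
  have hf : cfc f (spectralMatrix U p) = spectralMatrix V (fun i => f (q i)) := by
    rw [hX.cfc_eq]; rfl
  rw [hf]
  have key : ∀ g : ℝ → ℝ, spectralMatrix V (fun i => g (q i)) = spectralMatrix U (fun i => g (p i)) ↔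
      ∀ i j, (g (q i) : ℂ) * ((V : Matrix ι ι ℂ)ᴴ * (U : Matrix ι ι ℂ)) i j =
        ((V : Matrix ι ι ℂ)ᴴ * (U : Matrix ι ι ℂ)) i j * (g (p j) : ℂ) := by
    intro g
    have hV1 := unitaryGroup_conjTranspose_mul_self V
    have hU1 := unitaryGroup_conjTranspose_mul_self U
    have hV2 := unitaryGroup_mul_conjTranspose_self V
    have hU2 := unitaryGroup_mul_conjTranspose_self U
    have e : (∀ i j, (g (q i) : ℂ) * ((V : Matrix ι ι ℂ)ᴴ * (U : Matrix ι ι ℂ)) i j =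
        ((V : Matrix ι ι ℂ)ᴴ * (U : Matrix ι ι ℂ)) i j * (g (p j) : ℂ)) ↔
        Matrix.diagonal (fun i => (g (q i) : ℂ)) * ((V : Matrix ι ι ℂ)ᴴ * (U : Matrix ι ι ℂ)) =
        ((V : Matrix ι ι ℂ)ᴴ * (U : Matrix ι ι ℂ)) * Matrix.diagonal (fun i => (g (p i) : ℂ)) := by
      rw [← Matrix.ext_iff]
      simp only [Matrix.diagonal_mul, Matrix.mul_diagonal]
    rw [e]
    simp only [spectralMatrix]
    constructor
    · intro h
      have := congrArg (fun Z => (V : Matrix ι ι ℂ)ᴴ * Z * (U : Matrix ι ι ℂ)) h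
      simp only [Matrix.mul_assoc, hU1, Matrix.mul_one] at this
      rw [← Matrix.mul_assoc, hV1, Matrix.one_mul] at this
      rw [this, Matrix.mul_assoc]
    · intro h
      have := congrArg (fun Z => (V : Matrix ι ι ℂ) * Z * (U : Matrix ι ι ℂ)ᴴ) h
      simp only [Matrix.mul_assoc, hU2, Matrix.mul_one] at this
      rw [← Matrix.mul_assoc (V : Matrix ι ι ℂ) (V : Matrix ι ι ℂ)ᴴ, hV2, Matrix.one_mul] at this
      rw [Matrix.mul_assoc, this, Matrix.mul_assoc]
  rw [key]
  intro i j
  have hi := (key id).mp hV.symm i j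
  by_cases hz : ((V : Matrix ι ι ℂ)ᴴ * (U : Matrix ι ι ℂ)) i j = 0
  · simp [hz]
  · have : q i = p j := by
      simp only [id] at hi
      rw [mul_comm] at hi
      exact_mod_cast mul_left_cancel₀ hz hi
    rw [this, mul_comm]

lemma spectralMatrix_const (U : Matrix.unitaryGroup ι ℂ) (c : ℝ) :
    spectralMatrix U (fun _ => c) = (c : ℂ) • 1 := by
  rw [spectralMatrix, show Matrix.diagonal (fun _ : ι => (c : ℂ)) = (c : ℂ) • 1 by
    ext i j; simp [Matrix.diagonal_apply, Matrix.one_apply]]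
  simp [unitaryGroup_mul_conjTranspose_self]

end SpectralForm

lemma Matrix.PosSemidef.trace_re_nonneg {ι : Type*} [Fintype ι]
    {X : Matrix ι ι ℂ} (hX : X.PosSemidef) :
    0 ≤ X.trace.re :=
  (Complex.nonneg_iff.mp hX.trace_nonneg).1

/-! ### Kadison–Schwarz inequality and the modular quadratic form -/

section CompletelyPositive

lemma CStarAlgebra.exists_eq_star_mul_self {A : Type*} [CStarAlgebra A] [PartialOrder A]
    [StarOrderedRing A] {a : A} (ha : 0 ≤ a) : ∃ b, a = star b * b :=
  CStarAlgebra.nonneg_iff_eq_star_mul_self.mp ha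

variable {ι : Type*} [Fintype ι] [DecidableEq ι]

/-- The dual of `R` for the trace pairing, in the Heisenberg picture. -/
noncomputable def heisenbergDual (R : Matrix ι ι ℂ →CP Matrix ι ι ℂ) (Y : Matrix ι ι ℂ) :
    Matrix ι ι ℂ :=
  Matrix.of fun a b => (R (Matrix.single b a 1) * Y).trace

lemma trace_mul_heisenbergDual (R : Matrix ι ι ℂ →CP Matrix ι ι ℂ) (X Y : Matrix ι ι ℂ) :
    (X * heisenbergDual R Y).trace = (R X * Y).trace := by
  conv_rhs => rw [Matrix.matrix_eq_sum_single X]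
  simp only [map_sum, Finset.sum_mul, Matrix.trace_sum]
  rw [Matrix.trace]
  refine Finset.sum_congr rfl fun i _ => ?_
  rw [Matrix.diag_apply, Matrix.mul_apply]
  refine Finset.sum_congr rfl fun j _ => ?_
  have : Matrix.single i j (X i j) = X i j • Matrix.single i j (1 : ℂ) := by
    rw [Matrix.smul_single, smul_eq_mul, mul_one]
  rw [this, map_smul, Matrix.smul_mul, Matrix.trace_smul, heisenbergDual, Matrix.of_apply,
    smul_eq_mul]

lemma Matrix.PosSemidef.map_completelyPositive (R : Matrix ι ι ℂ →CP Matrix ι ι ℂ)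
    {X : Matrix ι ι ℂ} (hX : X.PosSemidef) : (R X).PosSemidef := by
  rw [← Matrix.nonneg_iff_posSemidef] at hX ⊢
  exact map_nonneg R hX

lemma completelyPositiveMap_conjTranspose (R : Matrix ι ι ℂ →CP Matrix ι ι ℂ)
    (X : Matrix ι ι ℂ) : R Xᴴ = (R X)ᴴ :=
  map_star R X

lemma heisenbergDual_conjTranspose (R : Matrix ι ι ℂ →CP Matrix ι ι ℂ) (Y : Matrix ι ι ℂ) :
    heisenbergDual R Yᴴ = (heisenbergDual R Y)ᴴ := by
  ext a b
  rw [Matrix.conjTranspose_apply, heisenbergDual, heisenbergDual, Matrix.of_apply, Matrix.of_apply,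
    ← Matrix.trace_conjTranspose, Matrix.conjTranspose_mul,
    ← completelyPositiveMap_conjTranspose, Matrix.trace_mul_comm]
  congr 3
  ext i j
  simp [Matrix.conjTranspose_apply, Matrix.single_apply, and_comm, apply_ite]

/-- The Kadison--Schwarz inequality for the dual of a completely positive map, tested against a
positive semidefinite matrix. -/
lemma trace_heisenbergDual_schwarz (R : Matrix ι ι ℂ →CP Matrix ι ι ℂ)
    (hR : ∀ X, (R X).trace = X.trace) {ρ : Matrix ι ι ℂ} (hρ : ρ.PosSemidef) (Y : Matrix ι ι ℂ) :
    (ρ * (heisenbergDual R Y * (heisenbergDual R Y)ᴴ)).trace.re ≤ (R ρ * (Y * Yᴴ)).trace.re := by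
  set X := heisenbergDual R Y with hX
  obtain ⟨S, hS⟩ := CStarAlgebra.nonneg_iff_eq_star_mul_self.mp
    (Matrix.nonneg_iff_posSemidef.mpr hρ)
  rw [Matrix.star_eq_conjTranspose] at hS
  -- With `ρ = Sᴴ S`, the block matrix `star N * N` has entries `ρ`, `-ρX`, `-Xᴴρ`, `XᴴρX`. Only
  -- 2-positivity of `R` is needed to keep it positive.
  let N : CStarMatrix (Fin 2) (Fin 2) (Matrix ι ι ℂ) :=
    CStarMatrix.ofMatrix !![S, -(S * X); 0, 0]
  have hM : 0 ≤ (star N * N).map R := R.map_cstarMatrix_nonneg _ (star_mul_self_nonneg N)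
  obtain ⟨K, hK⟩ := CStarAlgebra.exists_eq_star_mul_self hM
  have entry : ∀ i j, R ((star N * N) i j) = ∑ k, (K k i)ᴴ * K k j := fun i j => by
    have := congrFun (congrFun hK i) j
    rw [CStarMatrix.map_apply] at this
    rw [this, CStarMatrix.mul_apply]
    rfl
  have hN : ∀ i j, (star N * N) i j = ∑ k, (N k i)ᴴ * N k j := fun i j => by
    rw [CStarMatrix.mul_apply]
    rfl
  have n00 : (star N * N) 0 0 = ρ := by
    rw [hN, Fin.sum_univ_two, hS]; simp [N]
  have n01 : (star N * N) 0 1 = -(ρ * X) := by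
    rw [hN, Fin.sum_univ_two, hS]; simp [N, Matrix.mul_assoc]
  have n10 : (star N * N) 1 0 = -(Xᴴ * ρ) := by
    rw [hN, Fin.sum_univ_two, hS]; simp [N, Matrix.mul_assoc]
  have n11 : (star N * N) 1 1 = Xᴴ * ρ * X := by
    rw [hN, Fin.sum_univ_two, hS]; simp [N, Matrix.mul_assoc]
  have e00 := entry 0 0
  have e01 := entry 0 1
  have e10 := entry 1 0
  have e11 := entry 1 1
  rw [n00] at e00
  rw [n01] at e01
  rw [n10] at e10
  rw [n11] at e11
  -- This compresses the positive block matrix by the column `(Y, 1)`. By duality each cross term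
  -- has trace `-Tr ρXXᴴ`; trace preservation turns the last block into `+Tr ρXXᴴ`.
  have hpos : 0 ≤ (∑ k, (K k 0 * Y + K k 1)ᴴ * (K k 0 * Y + K k 1)).trace.re := by
    refine Matrix.PosSemidef.trace_re_nonneg ?_
    exact Matrix.posSemidef_sum _ fun k _ => Matrix.posSemidef_conjTranspose_mul_self _
  have hexp : ∑ k, (K k 0 * Y + K k 1)ᴴ * (K k 0 * Y + K k 1) =
      Yᴴ * R ρ * Y + Yᴴ * R (-(ρ * X)) + R (-(Xᴴ * ρ)) * Y + R (Xᴴ * ρ * X) := by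
    rw [e00, e01, e10, e11]
    simp only [Fin.sum_univ_two, Matrix.conjTranspose_add, Matrix.conjTranspose_mul,
      Matrix.add_mul, Matrix.mul_add, Matrix.mul_assoc]
    abel
  have t1 : (Yᴴ * R ρ * Y).trace = (R ρ * (Y * Yᴴ)).trace := by
    rw [Matrix.mul_assoc, Matrix.trace_mul_comm, Matrix.mul_assoc]
  have t2 : (Yᴴ * R (-(ρ * X))).trace = -(ρ * (X * Xᴴ)).trace := by
    rw [Matrix.trace_mul_comm, ← trace_mul_heisenbergDual, heisenbergDual_conjTranspose, ← hX,
      Matrix.neg_mul, Matrix.trace_neg, Matrix.mul_assoc]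
  have t3 : (R (-(Xᴴ * ρ)) * Y).trace = -(ρ * (X * Xᴴ)).trace := by
    rw [← trace_mul_heisenbergDual, ← hX, Matrix.neg_mul, Matrix.trace_neg, Matrix.mul_assoc,
      Matrix.trace_mul_comm, Matrix.mul_assoc]
  have t4 : (R (Xᴴ * ρ * X)).trace = (ρ * (X * Xᴴ)).trace := by
    rw [hR, Matrix.mul_assoc, Matrix.trace_mul_comm, Matrix.mul_assoc]
  rw [hexp, Matrix.trace_add, Matrix.trace_add, Matrix.trace_add, t1, t2, t3, t4] at hpos
  simp only [Complex.add_re, Complex.neg_re] at hpos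
  linarith

/-- The quadratic form whose supremum over `X` is the resolvent of the relative modular operator
of `τ` and `ρ`. -/
noncomputable def modularForm (t : ℝ) (τ ρ X : Matrix ι ι ℂ) : ℝ :=
  2 * (τ * X).trace.re - (ρ * (X * Xᴴ)).trace.re - t * (τ * (Xᴴ * X)).trace.re

lemma modularForm_map_le (R : Matrix ι ι ℂ →CP Matrix ι ι ℂ)
    (hR : ∀ X, (R X).trace = X.trace) {τ ρ : Matrix ι ι ℂ} (hτ : τ.PosSemidef)
    (hρ : ρ.PosSemidef) {t : ℝ} (ht : 0 ≤ t) (Y : Matrix ι ι ℂ) :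
    modularForm t (R τ) (R ρ) Y ≤ modularForm t τ ρ (heisenbergDual R Y) := by
  have h1 := trace_heisenbergDual_schwarz R hR hρ Y
  -- The adjoint supplies the opposite operator order, needed for the `τ` term.
  have h2 := trace_heisenbergDual_schwarz R hR hτ Yᴴ
  rw [heisenbergDual_conjTranspose, Matrix.conjTranspose_conjTranspose,
    Matrix.conjTranspose_conjTranspose] at h2
  have h3 := mul_le_mul_of_nonneg_left h2 ht
  rw [modularForm, modularForm, trace_mul_heisenbergDual]
  linarith

lemma trace_spectralMatrix_mul_general (U V : Matrix.unitaryGroup ι ℂ) (p : ι → ℝ)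
    (Z : Matrix ι ι ℂ) :
    (spectralMatrix U p * ((V : Matrix ι ι ℂ) * Z * (U : Matrix ι ι ℂ)ᴴ)).trace =
      ∑ i, ∑ j, (p i : ℂ) * (((U : Matrix ι ι ℂ)ᴴ * (V : Matrix ι ι ℂ)) i j * Z j i) := by
  have h : (spectralMatrix U p * ((V : Matrix ι ι ℂ) * Z * (U : Matrix ι ι ℂ)ᴴ)).trace =
      (Matrix.diagonal (fun i => (p i : ℂ)) *
        (((U : Matrix ι ι ℂ)ᴴ * (V : Matrix ι ι ℂ)) * Z)).trace := by
    simp only [spectralMatrix, Matrix.mul_assoc]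
    rw [Matrix.trace_mul_comm]
    simp only [Matrix.mul_assoc]
    rw [unitaryGroup_conjTranspose_mul_self, Matrix.mul_one]
  rw [h, Matrix.trace]
  refine Finset.sum_congr rfl fun i _ => ?_
  rw [Matrix.diag_apply, Matrix.diagonal_mul, Matrix.mul_apply, Finset.mul_sum]

lemma trace_spectralMatrix_mul_conj (V : Matrix.unitaryGroup ι ℂ) (q : ι → ℝ)
    (W : Matrix ι ι ℂ) :
    (spectralMatrix V q * ((V : Matrix ι ι ℂ) * (W * Wᴴ) * (V : Matrix ι ι ℂ)ᴴ)).trace.re =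
      ∑ j, q j * ∑ i, Complex.normSq (W j i) := by
  rw [trace_spectralMatrix_mul_general, unitaryGroup_conjTranspose_mul_self]
  simp only [Matrix.one_apply, ite_mul, one_mul, zero_mul, mul_ite, mul_zero, Finset.sum_ite_eq,
    Finset.mem_univ, if_true, Complex.re_sum, Complex.re_ofReal_mul]
  refine Finset.sum_congr rfl fun j _ => ?_
  rw [Matrix.mul_apply, Complex.re_sum]
  congr 1
  refine Finset.sum_congr rfl fun i _ => ?_
  simp [Matrix.conjTranspose_apply, Complex.normSq_apply]

/-- In the mixed basis, left and right multiplication are both diagonal, so the form decouples into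
one scalar quadratic for each entry of `Z`, and can be maximized entry by entry. -/
lemma modularForm_spectralMatrix (t : ℝ) (U V : Matrix.unitaryGroup ι ℂ) (p q : ι → ℝ)
    (Z : Matrix ι ι ℂ) :
    modularForm t (spectralMatrix U p) (spectralMatrix V q)
        ((V : Matrix ι ι ℂ) * Z * (U : Matrix ι ι ℂ)ᴴ) =
      ∑ i, ∑ j, (2 * p i * (((U : Matrix ι ι ℂ)ᴴ * (V : Matrix ι ι ℂ)) i j * Z j i).re -
        (q j + t * p i) * Complex.normSq (Z j i)) := by
  have hU := unitaryGroup_conjTranspose_mul_self U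
  have hV := unitaryGroup_conjTranspose_mul_self V
  have e1 : (V : Matrix ι ι ℂ) * Z * (U : Matrix ι ι ℂ)ᴴ *
      ((V : Matrix ι ι ℂ) * Z * (U : Matrix ι ι ℂ)ᴴ)ᴴ =
      (V : Matrix ι ι ℂ) * (Z * Zᴴ) * (V : Matrix ι ι ℂ)ᴴ := by
    simp only [Matrix.conjTranspose_mul, Matrix.conjTranspose_conjTranspose, Matrix.mul_assoc]
    rw [← Matrix.mul_assoc (U : Matrix ι ι ℂ)ᴴ, hU, Matrix.one_mul]
  have e2 : ((V : Matrix ι ι ℂ) * Z * (U : Matrix ι ι ℂ)ᴴ)ᴴ *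
      ((V : Matrix ι ι ℂ) * Z * (U : Matrix ι ι ℂ)ᴴ) =
      (U : Matrix ι ι ℂ) * (Zᴴ * Zᴴᴴ) * (U : Matrix ι ι ℂ)ᴴ := by
    simp only [Matrix.conjTranspose_mul, Matrix.conjTranspose_conjTranspose, Matrix.mul_assoc]
    rw [← Matrix.mul_assoc (V : Matrix ι ι ℂ)ᴴ, hV, Matrix.one_mul]
  rw [modularForm, e1, e2, trace_spectralMatrix_mul_conj, trace_spectralMatrix_mul_conj,
    trace_spectralMatrix_mul_general]
  simp only [Finset.sum_sub_distrib, add_mul, Finset.sum_add_distrib, Finset.mul_sum,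
    Complex.re_sum, Complex.re_ofReal_mul, Matrix.conjTranspose_apply, RCLike.star_def,
    Complex.normSq_conj, mul_assoc]
  rw [Finset.sum_comm (f := fun x i => q x * Complex.normSq (Z x i))]
  ring

lemma modularForm_spectralMatrix_le {t : ℝ} (ht : 0 ≤ t) (U V : Matrix.unitaryGroup ι ℂ)
    {p q : ι → ℝ} (hp : ∀ i, 0 ≤ p i) (hq : ∀ i, 0 < q i) (X : Matrix ι ι ℂ) :
    modularForm t (spectralMatrix U p) (spectralMatrix V q) X ≤
      ∑ i, ∑ j, overlap U V i j * (p i ^ 2 / (q j + t * p i)) := by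
  have hX : X = (V : Matrix ι ι ℂ) * ((V : Matrix ι ι ℂ)ᴴ * X * (U : Matrix ι ι ℂ)) *
      (U : Matrix ι ι ℂ)ᴴ := by
    rw [Matrix.mul_assoc, Matrix.mul_assoc, Matrix.mul_assoc,
      unitaryGroup_mul_conjTranspose_self, Matrix.mul_one, ← Matrix.mul_assoc,
      unitaryGroup_mul_conjTranspose_self, Matrix.one_mul]
  rw [hX, modularForm_spectralMatrix]
  refine Finset.sum_le_sum fun i _ => Finset.sum_le_sum fun j _ => ?_
  rw [overlap]
  generalize ((U : Matrix ι ι ℂ)ᴴ * (V : Matrix ι ι ℂ)) i j = c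
  generalize ((V : Matrix ι ι ℂ)ᴴ * X * (U : Matrix ι ι ℂ)) j i = z
  have hd : 0 < q j + t * p i := add_pos_of_pos_of_nonneg (hq j) (mul_nonneg ht (hp i))
  rw [← mul_div_assoc, le_div_iff₀ hd]
  generalize q j + t * p i = d at *
  simp only [Complex.normSq_apply, Complex.mul_re]
  nlinarith [sq_nonneg (p i * c.re - d * z.re), sq_nonneg (p i * c.im + d * z.im)]

lemma exists_modularForm_spectralMatrix_eq {t : ℝ} (ht : 0 ≤ t) (U V : Matrix.unitaryGroup ι ℂ)
    {p q : ι → ℝ} (hp : ∀ i, 0 ≤ p i) (hq : ∀ i, 0 < q i) :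
    ∃ X, modularForm t (spectralMatrix U p) (spectralMatrix V q) X =
      ∑ i, ∑ j, overlap U V i j * (p i ^ 2 / (q j + t * p i)) := by
  -- The entrywise maximizer, where the completed squares of the upper bound vanish.
  refine ⟨(V : Matrix ι ι ℂ) * (Matrix.of fun j i => ((p i / (q j + t * p i) : ℝ) : ℂ) *
    star (((U : Matrix ι ι ℂ)ᴴ * (V : Matrix ι ι ℂ)) i j)) * (U : Matrix ι ι ℂ)ᴴ, ?_⟩
  rw [modularForm_spectralMatrix]
  refine Finset.sum_congr rfl fun i _ => Finset.sum_congr rfl fun j _ => ?_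
  rw [overlap, Matrix.of_apply]
  generalize ((U : Matrix ι ι ℂ)ᴴ * (V : Matrix ι ι ℂ)) i j = c
  have hd : 0 < q j + t * p i := add_pos_of_pos_of_nonneg (hq j) (mul_nonneg ht (hp i))
  generalize q j + t * p i = d at *
  rw [Complex.normSq_mul, Complex.normSq_ofReal, RCLike.star_def, Complex.normSq_conj,
    mul_left_comm, Complex.mul_conj, ← Complex.ofReal_mul, Complex.ofReal_re]
  field_simp
  ring

end CompletelyPositive

/-! ### Data processing, Klein's inequality and entropy continuity -/

section RelativeEntropy

open Filter Topology

variable {ι : Type*} [Fintype ι] [DecidableEq ι]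

lemma sum_overlap_mul (U V : Matrix.unitaryGroup ι ℂ) (f : ι → ℝ) :
    ∑ i, ∑ j, overlap U V i j * f i = ∑ i, f i := by
  refine Finset.sum_congr rfl fun i _ => ?_
  rw [← Finset.sum_mul, sum_overlap, one_mul]

lemma sum_overlap_mul' (U V : Matrix.unitaryGroup ι ℂ) (f : ι → ℝ) :
    ∑ i, ∑ j, overlap U V i j * f j = ∑ j, f j := by
  rw [Finset.sum_comm]
  refine Finset.sum_congr rfl fun j _ => ?_
  rw [← Finset.sum_mul, sum_overlap', one_mul]

/-- The integral over `t ∈ [0, T]` of the resolvent of the relative modular operator. -/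
noncomputable def resolventIntegral (U V : Matrix.unitaryGroup ι ℂ) (p q : ι → ℝ) (T : ℝ) : ℝ :=
  ∑ i, ∑ j, overlap U V i j * (p i * (Real.log (q j + T * p i) - Real.log (q j)))

/-- The relative entropy of `spectralMatrix U p` with respect to `spectralMatrix V q`. -/
noncomputable def spectralRelEntropy (U V : Matrix.unitaryGroup ι ℂ) (p q : ι → ℝ) : ℝ :=
  ∑ i, ∑ j, overlap U V i j * (p i * (Real.log (p i) - Real.log (q j)))

lemma hasDerivAt_resolventIntegral (U V : Matrix.unitaryGroup ι ℂ) {p q : ι → ℝ}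
    (hp : ∀ i, 0 ≤ p i) (hq : ∀ i, 0 < q i) {T : ℝ} (hT : 0 ≤ T) :
    HasDerivAt (resolventIntegral U V p q)
      (∑ i, ∑ j, overlap U V i j * (p i ^ 2 / (q j + T * p i))) T := by
  refine HasDerivAt.fun_sum fun i _ => HasDerivAt.fun_sum fun j _ => ?_
  have hd : q j + T * p i ≠ 0 := (add_pos_of_pos_of_nonneg (hq j) (mul_nonneg hT (hp i))).ne'
  have h := ((((((hasDerivAt_id T).mul_const (p i)).const_add (q j)).log hd).sub_const
    (Real.log (q j))).const_mul (p i)).const_mul (overlap U V i j)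
  refine h.congr_deriv ?_
  rw [id, one_mul, ← mul_div_assoc, pow_two]

lemma resolventIntegral_zero (U V : Matrix.unitaryGroup ι ℂ) (p q : ι → ℝ) :
    resolventIntegral U V p q 0 = 0 := by
  simp [resolventIntegral]

/-- Since `log (q + T p) = log T + log (q / T + p)`, the divergence is exactly `log T` times the
trace. Terms with `p i = 0` vanish identically. -/
lemma tendsto_resolventIntegral (U V : Matrix.unitaryGroup ι ℂ) {p q : ι → ℝ}
    (hp : ∀ i, 0 ≤ p i) (hq : ∀ i, 0 < q i) :
    Tendsto (fun T => resolventIntegral U V p q T - Real.log T * ∑ i, p i) atTop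
      (𝓝 (spectralRelEntropy U V p q)) := by
  have h1 : Tendsto (fun T : ℝ => ∑ i, ∑ j, overlap U V i j *
      (p i * (Real.log (q j / T + p i) - Real.log (q j)))) atTop
      (𝓝 (spectralRelEntropy U V p q)) := by
    refine tendsto_finsetSum _ fun i _ => tendsto_finsetSum _ fun j _ => ?_
    refine Tendsto.const_mul _ ?_
    rcases (hp i).eq_or_lt with h0 | h0
    · simp [← h0]
    · refine Tendsto.const_mul _ (Tendsto.sub_const ?_ _)
      have : Tendsto (fun T : ℝ => q j / T + p i) atTop (𝓝 (p i)) := by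
        simpa using (tendsto_const_nhds.div_atTop tendsto_id).add_const (p i)
      exact this.log h0.ne'
  refine h1.congr' ?_
  filter_upwards [eventually_gt_atTop 0] with T hT
  rw [resolventIntegral, Finset.mul_sum,
    ← sum_overlap_mul U V fun i => Real.log T * p i, ← Finset.sum_sub_distrib]
  refine Finset.sum_congr rfl fun i _ => ?_
  rw [← Finset.sum_sub_distrib]
  refine Finset.sum_congr rfl fun j _ => ?_
  have hd : 0 < q j + T * p i := add_pos_of_pos_of_nonneg (hq j) (mul_nonneg hT.le (hp i))
  have : q j / T + p i = (q j + T * p i) / T := by field_simp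
  rw [this, Real.log_div hd.ne' hT.ne']
  ring

lemma posSemidef_spectralMatrix (U : Matrix.unitaryGroup ι ℂ) {p : ι → ℝ} (hp : ∀ i, 0 ≤ p i) :
    (spectralMatrix U p).PosSemidef := by
  refine Matrix.PosSemidef.mul_mul_conjTranspose_same (Matrix.PosSemidef.diagonal ?_) _
  intro i
  simpa using hp i

/-- **Data processing inequality** for the quantum relative entropy. -/
theorem spectralRelEntropy_map_le (R : Matrix ι ι ℂ →CP Matrix ι ι ℂ)
    (hR : ∀ X, (R X).trace = X.trace) {U V U' V' : Matrix.unitaryGroup ι ℂ} {p q p' q' : ι → ℝ}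
    (hp : ∀ i, 0 ≤ p i) (hq : ∀ i, 0 < q i) (hp' : ∀ i, 0 ≤ p' i) (hq' : ∀ i, 0 < q' i)
    (hU : R (spectralMatrix U p) = spectralMatrix U' p')
    (hV : R (spectralMatrix V q) = spectralMatrix V' q') :
    spectralRelEntropy U' V' p' q' ≤ spectralRelEntropy U V p q := by
  -- Equal traces make the divergent `log T` terms on both sides agree in the limit.
  have hsum : ∑ i, p' i = ∑ i, p i := by
    have := hR (spectralMatrix U p)
    rw [hU, trace_spectralMatrix, trace_spectralMatrix] at this
    exact_mod_cast this
  have hres : ∀ t : ℝ, 0 ≤ t → ∑ i, ∑ j, overlap U' V' i j * (p' i ^ 2 / (q' j + t * p' i)) ≤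
      ∑ i, ∑ j, overlap U V i j * (p i ^ 2 / (q j + t * p i)) := by
    intro t ht
    obtain ⟨Y, hY⟩ := exists_modularForm_spectralMatrix_eq ht U' V' hp' hq'
    rw [← hY, ← hU, ← hV]
    exact (modularForm_map_le R hR (posSemidef_spectralMatrix U hp)
      (posSemidef_spectralMatrix V fun i => (hq i).le) ht Y).trans
      (modularForm_spectralMatrix_le ht U V hp hq _)
  have hint : ∀ T : ℝ, 0 ≤ T → resolventIntegral U' V' p' q' T ≤ resolventIntegral U V p q T := by
    have hder : ∀ T : ℝ, 0 ≤ T → HasDerivAt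
        (fun T => resolventIntegral U V p q T - resolventIntegral U' V' p' q' T) _ T :=
      fun T hT => (hasDerivAt_resolventIntegral U V hp hq hT).fun_sub
        (hasDerivAt_resolventIntegral U' V' hp' hq' hT)
    have hmono : MonotoneOn
        (fun T => resolventIntegral U V p q T - resolventIntegral U' V' p' q' T) (Set.Ici 0) := by
      refine monotoneOn_of_deriv_nonneg (convex_Ici 0)
        (fun T hT => (hder T hT).continuousAt.continuousWithinAt)
        (fun T hT => ?_) (fun T hT => ?_)
      · rw [interior_Ici] at hT
        exact (hder T (le_of_lt hT)).differentiableAt.differentiableWithinAt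
      · rw [interior_Ici] at hT
        rw [(hder T (le_of_lt hT)).deriv]
        exact sub_nonneg.mpr (hres T (le_of_lt hT))
    intro T hT
    have := hmono (Set.self_mem_Ici) hT hT
    simp only [resolventIntegral_zero, sub_zero] at this
    linarith
  refine le_of_tendsto_of_tendsto (tendsto_resolventIntegral U' V' hp' hq')
    (tendsto_resolventIntegral U V hp hq) ?_
  filter_upwards [eventually_ge_atTop 0] with T hT
  rw [hsum]
  linarith [hint T hT]

lemma spectralRelEntropy_eq (U V : Matrix.unitaryGroup ι ℂ) (p q : ι → ℝ) :
    spectralRelEntropy U V p q = ∑ i, p i * Real.log (p i) -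
      (spectralMatrix U p * spectralMatrix V (fun j => Real.log (q j))).trace.re := by
  rw [trace_spectralMatrix_mul, Complex.ofReal_re, ← sum_overlap_mul U V fun i => p i * _,
    ← Finset.sum_sub_distrib, spectralRelEntropy]
  refine Finset.sum_congr rfl fun i _ => ?_
  rw [← Finset.sum_sub_distrib]
  refine Finset.sum_congr rfl fun j _ => ?_
  ring

/-- **Klein's inequality**. -/
theorem spectralRelEntropy_nonneg (U V : Matrix.unitaryGroup ι ℂ) {p q : ι → ℝ}
    (hp : ∀ i, 0 ≤ p i) (hq : ∀ i, 0 < q i) (hpq : ∑ i, q i ≤ ∑ i, p i) :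
    0 ≤ spectralRelEntropy U V p q := by
  -- Termwise this is `log x ≤ x - 1` at `x = q j / p i`.
  have h : ∑ i, ∑ j, overlap U V i j * (p i - q j) ≤ spectralRelEntropy U V p q := by
    refine Finset.sum_le_sum fun i _ => Finset.sum_le_sum fun j _ =>
      mul_le_mul_of_nonneg_left ?_ (overlap_nonneg U V i j)
    rcases (hp i).eq_or_lt with h0 | h0
    · simp [← h0, (hq j).le]
    · have := Real.log_le_sub_one_of_pos (div_pos (hq j) h0)
      rw [Real.log_div (hq j).ne' h0.ne'] at this
      have h2 := mul_le_mul_of_nonneg_left this h0.le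
      rw [mul_sub (p i) (q j / p i), mul_div_cancel₀ _ h0.ne'] at h2
      nlinarith
  simp only [mul_sub, Finset.sum_sub_distrib, sum_overlap_mul, sum_overlap_mul'] at h
  linarith

lemma abs_trace_spectralMatrix_mul_le (U V : Matrix.unitaryGroup ι ℂ) (p k : ι → ℝ) {M : ℝ}
    (hk : ∀ j, |k j| ≤ M) :
    |(spectralMatrix U p * spectralMatrix V k).trace.re| ≤ (∑ i, |p i|) * M := by
  rw [trace_spectralMatrix_mul, Complex.ofReal_re, Finset.sum_mul,
    ← sum_overlap_mul U V fun i => |p i| * M]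
  refine (Finset.abs_sum_le_sum_abs _ _).trans (Finset.sum_le_sum fun i _ => ?_)
  refine (Finset.abs_sum_le_sum_abs _ _).trans (Finset.sum_le_sum fun j _ => ?_)
  rw [abs_mul, abs_mul, abs_of_nonneg (overlap_nonneg U V i j)]
  exact mul_le_mul_of_nonneg_left (mul_le_mul_of_nonneg_left (hk j) (abs_nonneg _))
    (overlap_nonneg U V i j)

lemma abs_le_norm_spectralMatrix (V : Matrix.unitaryGroup ι ℂ) (k : ι → ℝ) (j : ι) :
    |k j| ≤ ‖spectralMatrix V k‖ := by
  have h : ‖spectralMatrix V k‖ = ‖fun i => (k i : ℂ)‖ := by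
    have := CStarRing.norm_mul_coe_unitary
      ((V : Matrix ι ι ℂ) * Matrix.diagonal (fun i => (k i : ℂ))) (star V)
    rw [← Matrix.l2_opNorm_diagonal,
      ← CStarRing.norm_coe_unitary_mul V (Matrix.diagonal fun i => (k i : ℂ)), ← this]
    rfl
  rw [h]
  simpa using norm_le_pi_norm (fun i => (k i : ℂ)) j

lemma sub_spectralMatrix (V : Matrix.unitaryGroup ι ℂ) (k l : ι → ℝ) :
    spectralMatrix V k - spectralMatrix V l = spectralMatrix V (fun i => k i - l i) := by
  simp only [spectralMatrix, ← Matrix.sub_mul, ← Matrix.mul_sub, Matrix.diagonal_sub,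
    Complex.ofReal_sub]

lemma smul_spectralMatrix (c : ℝ) (V : Matrix.unitaryGroup ι ℂ) (k : ι → ℝ) :
    (c : ℂ) • spectralMatrix V k = spectralMatrix V (fun i => c * k i) := by
  simp only [spectralMatrix]
  rw [← Matrix.smul_mul, ← Matrix.mul_smul, ← Matrix.diagonal_smul]
  congr 3
  ext i
  simp

/-- Continuity of the entropy, for states `spectralMatrix U p` and `spectralMatrix V s` whose
difference `spectralMatrix W δ` has trace norm at most `ε`. -/
theorem entropy_sub_le_of_spectral [Nonempty ι] {U V W : Matrix.unitaryGroup ι ℂ}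
    {p s δ : ι → ℝ} (hp : ∀ i, 0 ≤ p i) (hs : ∀ i, 0 ≤ s i) (hp1 : ∑ i, p i = 1)
    (hs1 : ∑ i, s i = 1) (hW : spectralMatrix U p - spectralMatrix V s = spectralMatrix W δ)
    {ε : ℝ} (hε : 0 < ε) (hδ : ∑ i, |δ i| ≤ ε) :
    ∑ i, s i * Real.log (s i) - ∑ i, p i * Real.log (p i) ≤
      ε / 2 * Real.log ((Fintype.card ι : ℝ) * (1 + ε) / ε) + Real.log (1 + ε) := by
  set d : ℝ := (Fintype.card ι : ℝ) with hd
  have hdpos : 0 < d := by rw [hd]; exact_mod_cast Fintype.card_pos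
  set L := Real.log (d * (1 + ε) / ε) with hL
  -- The second state mixed with a little of the maximally mixed one: full rank, so Klein's
  -- inequality applies, with logarithm in `[-L, 0]`, and still at least `s / (1 + ε)`.
  set ω : ι → ℝ := fun j => (s j + ε / d) / (1 + ε) with hω
  have hε1 : 0 < 1 + ε := by linarith
  have hωpos : ∀ j, 0 < ω j := fun j =>
    div_pos (add_pos_of_nonneg_of_pos (hs j) (div_pos hε hdpos)) hε1
  have hωsum : ∑ j, ω j = 1 := by
    rw [hω, ← Finset.sum_div, Finset.sum_add_distrib, hs1, Finset.sum_const, Finset.card_univ,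
      nsmul_eq_mul, ← hd, mul_div_cancel₀ _ hdpos.ne', div_self hε1.ne']
  have hωle : ∀ j, ω j ≤ 1 := fun j => by
    rw [← hωsum]
    exact Finset.single_le_sum (fun i _ => (hωpos i).le) (Finset.mem_univ j)
  have hlogle : ∀ j, Real.log (ω j) ≤ 0 := fun j =>
    Real.log_nonpos (hωpos j).le (hωle j)
  have hlogge : ∀ j, -L ≤ Real.log (ω j) := fun j => by
    rw [hL, ← Real.log_inv]
    refine Real.log_le_log (by positivity) ?_
    rw [hω, inv_div, div_mul_eq_div_div]
    exact div_le_div_of_nonneg_right (le_add_of_nonneg_left (hs j)) hε1.le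
  have hLnonneg : 0 ≤ L := by
    have j := Classical.arbitrary ι
    linarith [hlogle j, hlogge j]
  have hklein := spectralRelEntropy_nonneg U V hp hωpos (by rw [hωsum, hp1])
  rw [spectralRelEntropy_eq] at hklein
  -- The difference of states is traceless, so the logarithm may be centred at `-L/2`. This halves
  -- its norm and yields the factor `ε / 2`.
  have hshift : (spectralMatrix U p - spectralMatrix V s) *
      spectralMatrix V (fun j => Real.log (ω j)) = spectralMatrix W δ *
        spectralMatrix V (fun j => Real.log (ω j) - -(L / 2)) +
      ((-(L / 2) : ℝ) : ℂ) • (spectralMatrix U p - spectralMatrix V s) := by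
    rw [← sub_spectralMatrix, spectralMatrix_const, Matrix.mul_sub, Matrix.mul_smul, hW,
      Matrix.mul_one]
    abel
  have htr : (spectralMatrix U p - spectralMatrix V s).trace = 0 := by
    rw [Matrix.trace_sub, trace_spectralMatrix, trace_spectralMatrix, hp1, hs1, sub_self]
  have hbound := abs_trace_spectralMatrix_mul_le W V δ
    (fun j => Real.log (ω j) - -(L / 2)) (M := L / 2) fun j => by
      rw [abs_le]
      constructor <;> linarith [hlogle j, hlogge j]
  have hδL : (∑ i, |δ i|) * (L / 2) ≤ ε * (L / 2) :=
    mul_le_mul_of_nonneg_right hδ (by linarith)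
  have hdiff := congrArg (fun X => X.trace.re) hshift
  simp only [Matrix.trace_add, Matrix.trace_smul, htr, smul_zero, add_zero, Matrix.sub_mul,
    Matrix.trace_sub, Complex.sub_re] at hdiff
  have hself : (spectralMatrix V s * spectralMatrix V (fun j => Real.log (ω j))).trace.re =
      ∑ j, s j * Real.log (ω j) := by
    rw [trace_spectralMatrix_mul, Complex.ofReal_re]
    simp [overlap_self]
  have hσ : ∑ j, s j * Real.log (s j) - Real.log (1 + ε) ≤ ∑ j, s j * Real.log (ω j) := by
    have h1 : ∑ j, s j * Real.log (1 + ε) = Real.log (1 + ε) := by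
      rw [← Finset.sum_mul, hs1, one_mul]
    rw [← h1, ← Finset.sum_sub_distrib]
    refine Finset.sum_le_sum fun j _ => ?_
    rcases (hs j).eq_or_lt with h0 | h0
    · simp [← h0]
    · rw [← mul_sub, ← Real.log_div h0.ne' hε1.ne']
      refine mul_le_mul_of_nonneg_left (Real.log_le_log (div_pos h0 hε1) ?_) h0.le
      exact div_le_div_of_nonneg_right (le_add_of_nonneg_right (by positivity)) hε1.le
  have := (abs_le.mp hbound).1
  linarith

end RelativeEntropy

/-! ### Partial traces, product states and locality -/

section RegionLemmas

variable {Λ : Type*} [Fintype Λ] [DecidableEq Λ]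

/-- Configurations on all sites are pairs of configurations on `A` and on its complement. -/
def splitEquiv (A : Finset Λ) : (Λ → Fin 2) ≃ (A → Fin 2) × (↥(Aᶜ) → Fin 2) where
  toFun x := (fun i => x i, fun i => x i)
  invFun a := glue A a.1 a.2
  left_inv x := by
    funext i
    simp only [glue]
    split_ifs <;> rfl
  right_inv a := by
    refine Prod.ext (funext fun i => ?_) (funext fun i => ?_)
    · simp [glue, i.2]
    · simp [glue, Finset.mem_compl.mp i.2]

lemma regionTensor_eq_submatrix (A : Finset Λ) (X : QubitOp A) (Y : QubitOp ↥(Aᶜ)) :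
    regionTensor A X Y = (X ⊗ₖ Y).submatrix (splitEquiv A) (splitEquiv A) :=
  rfl

lemma splitEquiv_glue (A : Finset Λ) (a : A → Fin 2) (z : ↥(Aᶜ) → Fin 2) :
    splitEquiv A (glue A a z) = (a, z) :=
  (splitEquiv A).apply_symm_apply (a, z)

lemma regionTensor_glue (A : Finset Λ) (X : QubitOp A) (Y : QubitOp ↥(Aᶜ))
    (a b : A → Fin 2) (z w : ↥(Aᶜ) → Fin 2) :
    regionTensor A X Y (glue A a z) (glue A b w) = X a b * Y z w := by
  rw [regionTensor_eq_submatrix, Matrix.submatrix_apply, splitEquiv_glue, splitEquiv_glue]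
  rfl

lemma sum_glue {M : Type*} [AddCommMonoid M] (A : Finset Λ) (f : (Λ → Fin 2) → M) :
    ∑ x, f x = ∑ a, ∑ z, f (glue A a z) := by
  rw [← Fintype.sum_prod_type' fun a z => f (glue A a z)]
  exact (Equiv.sum_comp (splitEquiv A).symm f).symm

lemma marginal_apply (A : Finset Λ) (σ : QubitOp Λ) (x y : A → Fin 2) :
    marginal A σ x y = ∑ z, σ (glue A x z) (glue A y z) :=
  rfl

lemma marginal_compl_apply (A : Finset Λ) (σ : QubitOp Λ) (z w : ↥(Aᶜ) → Fin 2) :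
    marginal Aᶜ σ z w = ∑ a, σ (glue A a z) (glue A a w) := by
  -- The inner sum runs over configurations on `Aᶜᶜ`, a different type from those on `A`.
  let e : A ≃ ↥(Aᶜᶜ) := Equiv.subtypeEquivRight fun i => by simp
  have he : ∀ (a : A → Fin 2) (u : ↥(Aᶜ) → Fin 2),
      glue Aᶜ u (a ∘ e.symm) = glue A a u := by
    intro a u
    funext i
    by_cases h : i ∈ A
    · simp only [glue, Finset.mem_compl, h, not_true_eq_false, dif_neg, not_false_eq_true, dif_pos]
      rfl
    · simp [glue, h]
  rw [marginal_apply, ← Equiv.sum_comp (e.arrowCongr (Equiv.refl (Fin 2)))]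
  refine Finset.sum_congr rfl fun a _ => ?_
  rw [← he a z, ← he a w]
  rfl

lemma trace_marginal (A : Finset Λ) (σ : QubitOp Λ) : (marginal A σ).trace = σ.trace := by
  rw [Matrix.trace, Matrix.trace, sum_glue A]
  rfl

lemma posSemidef_marginal {σ : QubitOp Λ} (hσ : σ.PosSemidef) (A : Finset Λ) :
    (marginal A σ).PosSemidef := by
  have : marginal A σ = ∑ z : ↥(Aᶜ) → Fin 2,
      σ.submatrix (fun x => glue A x z) (fun x => glue A x z) := by
    ext x y
    rw [Matrix.sum_apply]
    rfl
  rw [this]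
  exact Matrix.posSemidef_sum _ fun z _ => hσ.submatrix _

lemma IsQuantumState.marginal {σ : QubitOp Λ} (hσ : IsQuantumState σ) (A : Finset Λ) :
    IsQuantumState (marginal A σ) :=
  ⟨posSemidef_marginal hσ.1 A, (trace_marginal A σ).trans hσ.2⟩

lemma marginal_regionTensor (A : Finset Λ) (X : QubitOp A) (Y : QubitOp ↥(Aᶜ)) :
    marginal A (regionTensor A X Y) = Y.trace • X := by
  ext a b
  rw [marginal_apply, Matrix.smul_apply, smul_eq_mul, Matrix.trace, Finset.sum_mul]
  refine Finset.sum_congr rfl fun z _ => ?_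
  rw [regionTensor_glue, mul_comm]
  rfl

lemma marginal_compl_regionTensor (A : Finset Λ) (X : QubitOp A) (Y : QubitOp ↥(Aᶜ)) :
    marginal Aᶜ (regionTensor A X Y) = X.trace • Y := by
  ext z w
  rw [marginal_compl_apply, Matrix.smul_apply, smul_eq_mul, Matrix.trace, Finset.sum_mul]
  refine Finset.sum_congr rfl fun a _ => ?_
  rw [regionTensor_glue]
  rfl

lemma trace_regionTensor (A : Finset Λ) (X : QubitOp A) (Y : QubitOp ↥(Aᶜ)) :
    (regionTensor A X Y).trace = X.trace * Y.trace := by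
  rw [← trace_marginal A, marginal_regionTensor, Matrix.trace_smul, smul_eq_mul, mul_comm]

lemma exists_regionTensor_spectralMatrix (A : Finset Λ)
    (U : Matrix.unitaryGroup (A → Fin 2) ℂ) (V : Matrix.unitaryGroup (↥(Aᶜ) → Fin 2) ℂ)
    (p : (A → Fin 2) → ℝ) (q : (↥(Aᶜ) → Fin 2) → ℝ) :
    ∃ W : Matrix.unitaryGroup (Λ → Fin 2) ℂ,
      regionTensor A (spectralMatrix U p) (spectralMatrix V q) =
        spectralMatrix W fun x => p (splitEquiv A x).1 * q (splitEquiv A x).2 := by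
  have hmem : regionTensor A (U : QubitOp A) (V : QubitOp ↥(Aᶜ)) ∈
      Matrix.unitaryGroup (Λ → Fin 2) ℂ := by
    rw [Matrix.mem_unitaryGroup_iff, Matrix.star_eq_conjTranspose, regionTensor_eq_submatrix,
      Matrix.conjTranspose_submatrix, Matrix.submatrix_mul_equiv, Matrix.conjTranspose_kronecker,
      ← Matrix.mul_kronecker_mul, unitaryGroup_mul_conjTranspose_self,
      unitaryGroup_mul_conjTranspose_self, Matrix.one_kronecker_one, Matrix.submatrix_one_equiv]
  refine ⟨⟨_, hmem⟩, ?_⟩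
  have hdiag : Matrix.diagonal (fun x => ((p (splitEquiv A x).1 * q (splitEquiv A x).2 : ℝ) : ℂ)) =
      (Matrix.diagonal (fun i => (p i : ℂ)) ⊗ₖ Matrix.diagonal (fun i => (q i : ℂ))).submatrix
        (splitEquiv A) (splitEquiv A) := by
    rw [Matrix.diagonal_kronecker_diagonal, Matrix.submatrix_diagonal_equiv]
    congr 1
    funext x
    simp
  simp only [spectralMatrix]
  rw [hdiag]
  simp only [regionTensor_eq_submatrix]
  rw [Matrix.conjTranspose_submatrix, Matrix.submatrix_mul_equiv, Matrix.submatrix_mul_equiv,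
    Matrix.conjTranspose_kronecker, Matrix.mul_kronecker_mul, Matrix.mul_kronecker_mul]

lemma vonNeumannEntropy_spectralMatrix (U : Matrix.unitaryGroup (Λ → Fin 2) ℂ)
    (p : (Λ → Fin 2) → ℝ) :
    vonNeumannEntropy (spectralMatrix U p) = -∑ i, p i * Real.log (p i) := by
  rw [vonNeumannEntropy, CFC.log, cfc_spectralMatrix, trace_spectralMatrix_mul, Complex.ofReal_re]
  simp [overlap_self]

lemma traceNorm_spectralMatrix (U : Matrix.unitaryGroup (Λ → Fin 2) ℂ)
    (p : (Λ → Fin 2) → ℝ) :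
    traceNorm (spectralMatrix U p) = ∑ i, |p i| := by
  have : CFC.abs (spectralMatrix U p) = cfc (fun x : ℝ => ‖x‖) (spectralMatrix U p) :=
    CFC.abs_eq_cfc_norm _ (isHermitian_spectralMatrix U p)
  rw [traceNorm, this, cfc_spectralMatrix, trace_spectralMatrix, Complex.ofReal_re]
  simp only [Real.norm_eq_abs]

lemma IsQuantumState.exists_eq_spectralMatrix {σ : QubitOp Λ} (hσ : IsQuantumState σ) :
    ∃ (U : Matrix.unitaryGroup (Λ → Fin 2) ℂ) (p : (Λ → Fin 2) → ℝ),
      σ = spectralMatrix U p ∧ (∀ i, 0 ≤ p i) ∧ ∑ i, p i = 1 := by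
  refine ⟨_, _, hσ.1.isHermitian.exists_eq_spectralMatrix, hσ.1.eigenvalues_nonneg, ?_⟩
  have h := hσ.2
  rw [hσ.1.isHermitian.exists_eq_spectralMatrix, trace_spectralMatrix] at h
  exact_mod_cast h

/-- Additivity of the von Neumann entropy on product states. -/
lemma vonNeumannEntropy_regionTensor {A : Finset Λ} {X : QubitOp A} {Y : QubitOp ↥(Aᶜ)}
    (hX : IsQuantumState X) (hY : IsQuantumState Y) :
    vonNeumannEntropy (regionTensor A X Y) = vonNeumannEntropy X + vonNeumannEntropy Y := by
  obtain ⟨U, p, rfl, -, hp⟩ := hX.exists_eq_spectralMatrix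
  obtain ⟨V, q, rfl, -, hq⟩ := hY.exists_eq_spectralMatrix
  obtain ⟨W, hW⟩ := exists_regionTensor_spectralMatrix A U V p q
  rw [hW, vonNeumannEntropy_spectralMatrix, vonNeumannEntropy_spectralMatrix,
    vonNeumannEntropy_spectralMatrix, sum_glue A]
  simp only [splitEquiv_glue]
  have hterm : ∀ a z, p a * q z * Real.log (p a * q z) =
      p a * Real.log (p a) * q z + p a * (q z * Real.log (q z)) := by
    intro a z
    by_cases hpa : p a = 0
    · simp [hpa]
    by_cases hqz : q z = 0
    · simp [hqz]
    rw [Real.log_mul hpa hqz]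
    ring
  simp only [hterm, Finset.sum_add_distrib, ← Finset.mul_sum, ← Finset.sum_mul, hp, hq, one_mul,
    mul_one]
  ring

lemma isQuantumState_regionTensor {A : Finset Λ} {X : QubitOp A} {Y : QubitOp ↥(Aᶜ)}
    (hX : IsQuantumState X) (hY : IsQuantumState Y) : IsQuantumState (regionTensor A X Y) := by
  refine ⟨?_, by rw [trace_regionTensor, hX.2, hY.2, one_mul]⟩
  rw [regionTensor_eq_submatrix]
  exact (hX.1.kronecker hY.1).submatrix _

lemma ActsTriviallyAt.apply_update {O : QubitOp Λ} {i : Λ} (h : ActsTriviallyAt O i)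
    {x y : Λ → Fin 2} (hxy : x i = y i) (b : Fin 2) :
    O (Function.update x i b) (Function.update y i b) = O x y := by
  obtain ⟨O', rfl⟩ := h
  have hne : ∀ j : ↥(({i} : Finset Λ)ᶜ), (j : Λ) ≠ i := fun j => by
    simpa using Finset.mem_compl.mp j.2
  have h1 : ∀ j : ↥({i} : Finset Λ), (j : Λ) = i := fun j => Finset.mem_singleton.mp j.2
  simp [regionTensor, Matrix.submatrix_apply, Matrix.kroneckerMap_apply, hne, h1, hxy]

lemma ActsTriviallyAt.apply_eq_zero {O : QubitOp Λ} {i : Λ} (h : ActsTriviallyAt O i)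
    {x y : Λ → Fin 2} (hxy : x i ≠ y i) : O x y = 0 := by
  obtain ⟨O', rfl⟩ := h
  rw [regionTensor, Matrix.submatrix_apply, Matrix.kroneckerMap_apply, Matrix.one_apply_ne,
    zero_mul]
  exact fun he => hxy (congrFun he ⟨i, Finset.mem_singleton_self i⟩)

/-- Triviality is given site by site; induction on `B`, overwriting one site of both configurations
at a time, upgrades it to the whole region. -/
lemma apply_eq_of_actsTriviallyAt {O : QubitOp Λ} (B : Finset Λ)
    (hB : ∀ i ∈ B, ActsTriviallyAt O i) :
    ∀ x y x' y' : Λ → Fin 2, (∀ i ∈ B, x i = y i) → (∀ i ∈ B, x' i = y' i) →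
      (∀ i ∉ B, x i = x' i) → (∀ i ∉ B, y i = y' i) → O x y = O x' y' := by
  induction B using Finset.induction_on with
  | empty =>
    intro x y x' y' _ _ hx hy
    rw [funext fun i => hx i (Finset.notMem_empty i), funext fun i => hy i (Finset.notMem_empty i)]
  | insert i B hi ih =>
    intro x y x' y' h h' hx hy
    rw [← (hB i (Finset.mem_insert_self i B)).apply_update (h i (Finset.mem_insert_self i B)) (x' i)]
    refine ih (fun j hj => hB j (Finset.mem_insert_of_mem hj)) _ _ _ _ (fun j hj => ?_)
      (fun j hj => h' j (Finset.mem_insert_of_mem hj)) (fun j hj => ?_) (fun j hj => ?_)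
    · have hji : j ≠ i := fun e => hi (e ▸ hj)
      simp [hji, h j (Finset.mem_insert_of_mem hj)]
    · by_cases hji : j = i
      · subst hji; simp
      · simp [hji, hx j (by simp [hji, hj])]
    · by_cases hji : j = i
      · subst hji; simp [h' j (Finset.mem_insert_self j B)]
      · simp [hji, hy j (by simp [hji, hj])]

/-- The point is that `σ` enters only through its marginal off `A`. The configuration `0` on `A` is
an arbitrary reference. -/
lemma trace_mul_eq_of_actsTriviallyAt {A : Finset Λ} {O : QubitOp Λ}
    (hO : ∀ i ∈ A, ActsTriviallyAt O i) (σ : QubitOp Λ) :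
    (O * σ).trace =
      ∑ z, ∑ w, O (glue A 0 z) (glue A 0 w) * marginal Aᶜ σ w z := by
  have hdiag : ∀ a z b w, O (glue A a z) (glue A b w) =
      if a = b then O (glue A 0 z) (glue A 0 w) else 0 := by
    intro a z b w
    split_ifs with hab
    · subst hab
      refine apply_eq_of_actsTriviallyAt A hO _ _ _ _ ?_ ?_ ?_ ?_ <;>
        · intro i hi
          simp [glue, hi]
    · obtain ⟨i, hi⟩ := Function.ne_iff.mp hab
      refine (hO i i.2).apply_eq_zero ?_
      simpa [glue] using hi
  have hrow : ∀ a z, ∑ y, O (glue A a z) y * σ y (glue A a z) =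
      ∑ w, O (glue A 0 z) (glue A 0 w) * σ (glue A a w) (glue A a z) := by
    intro a z
    rw [sum_glue A, Finset.sum_comm]
    refine Finset.sum_congr rfl fun w _ => ?_
    rw [Finset.sum_eq_single a, hdiag, if_pos rfl]
    · intro b _ hb
      rw [hdiag, if_neg (Ne.symm hb), zero_mul]
    · simp
  rw [Matrix.trace]
  simp only [Matrix.diag_apply, Matrix.mul_apply]
  rw [sum_glue A, Finset.sum_comm]
  refine Finset.sum_congr rfl fun z _ => ?_
  rw [Finset.sum_congr rfl fun a _ => hrow a z, Finset.sum_comm]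
  refine Finset.sum_congr rfl fun w _ => ?_
  rw [marginal_compl_apply, Finset.mul_sum]

lemma trace_mul_eq_of_not_crossesCut {A : Finset Λ} {O σ τ : QubitOp Λ} (hO : ¬ CrossesCut A O)
    (hA : marginal A σ = marginal A τ) (hA' : marginal Aᶜ σ = marginal Aᶜ τ) :
    (O * σ).trace = (O * τ).trace := by
  rw [CrossesCut, not_and_or] at hO
  rcases hO with h | h
  · have hO' : ∀ i ∈ A, ActsTriviallyAt O i := fun i hi => by
      by_contra hc
      exact h ⟨i, hi, hc⟩
    rw [trace_mul_eq_of_actsTriviallyAt hO', trace_mul_eq_of_actsTriviallyAt hO', hA']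
  · have hO' : ∀ i ∈ Aᶜ, ActsTriviallyAt O i := fun i hi => by
      by_contra hc
      exact h ⟨i, hi, hc⟩
    have hA2 : marginal Aᶜᶜ σ = marginal Aᶜᶜ τ := by
      rw [compl_compl]
      exact hA
    rw [trace_mul_eq_of_actsTriviallyAt hO', trace_mul_eq_of_actsTriviallyAt hO', hA2]

/-- A term that does not cross the cut acts trivially on one whole side, so its expectation is fixed
by the marginal on the other side and cancels. -/
lemma trace_sum_mul_sub {Γ : Type*} [Fintype Γ] {A : Finset Λ} (h : Γ → QubitOp Λ)
    {σ τ : QubitOp Λ} (hA : marginal A σ = marginal A τ) (hA' : marginal Aᶜ σ = marginal Aᶜ τ) :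
    ((∑ γ, h γ) * σ).trace - ((∑ γ, h γ) * τ).trace =
      (boundaryHamiltonian A h * σ).trace - (boundaryHamiltonian A h * τ).trace := by
  classical
  have hsplit : ∑ γ, h γ = boundaryHamiltonian A h + ∑ γ with ¬ CrossesCut A (h γ), h γ := by
    rw [boundaryHamiltonian]
    convert (Finset.sum_filter_add_sum_filter_not Finset.univ (fun γ => CrossesCut A (h γ)) h).symm
  have hrest : ((∑ γ with ¬ CrossesCut A (h γ), h γ) * σ).trace =
      ((∑ γ with ¬ CrossesCut A (h γ), h γ) * τ).trace := by
    simp only [Finset.sum_mul, Matrix.trace_sum]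
    refine Finset.sum_congr rfl fun γ hγ => ?_
    exact trace_mul_eq_of_not_crossesCut (Finset.mem_filter.mp hγ).2 hA hA'
  rw [hsplit, Matrix.add_mul, Matrix.add_mul, Matrix.trace_add, Matrix.trace_add, hrest]
  ring

end RegionLemmas

/-! ### Free energy, trace-norm estimates and error bookkeeping -/

section GibbsStates

variable {Λ : Type*} [Fintype Λ] [DecidableEq Λ]

lemma gibbsState_spectralMatrix (β : ℝ) (V : Matrix.unitaryGroup (Λ → Fin 2) ℂ)
    (e : (Λ → Fin 2) → ℝ) :
    ∃ Z : ℝ, 0 < Z ∧ gibbsState β (spectralMatrix V e) =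
      spectralMatrix V fun j => Real.exp (-β * e j) / Z := by
  have hexp : NormedSpace.exp (-(β : ℂ) • spectralMatrix V e) =
      spectralMatrix V fun j => Real.exp (-β * e j) := by
    rw [← Complex.ofReal_neg, smul_spectralMatrix,
      ← CFC.real_exp_eq_normedSpace_exp (isHermitian_spectralMatrix V _), cfc_spectralMatrix]
  refine ⟨∑ j, Real.exp (-β * e j),
    Finset.sum_pos (fun j _ => Real.exp_pos _) Finset.univ_nonempty, ?_⟩
  rw [gibbsState, hexp, trace_spectralMatrix, ← Complex.ofReal_inv, smul_spectralMatrix]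
  congr 1
  funext j
  rw [div_eq_inv_mul]

/-- A channel that preserves the Gibbs state can increase the energy only as much as it increases
`β⁻¹` times the entropy: the free energy does not increase. -/
theorem vonNeumannEntropy_sub_map_le {H : QubitOp Λ} (hH : H.IsHermitian) (β : ℝ)
    (R : QubitOp Λ →CP QubitOp Λ) (hR : IsTracePreserving R)
    (hRfix : R (gibbsState β H) = gibbsState β H) {τ : QubitOp Λ} (hτ : IsQuantumState τ)
    (hRτ : IsQuantumState (R τ)) :
    vonNeumannEntropy τ - vonNeumannEntropy (R τ) ≤
      β * ((τ * H).trace.re - (R τ * H).trace.re) := by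
  obtain ⟨U, p, hU, hp, hp1⟩ := hτ.exists_eq_spectralMatrix
  obtain ⟨U', p', hU', hp', hp1'⟩ := hRτ.exists_eq_spectralMatrix
  obtain ⟨V, e, hV⟩ : ∃ (V : Matrix.unitaryGroup (Λ → Fin 2) ℂ) (e : (Λ → Fin 2) → ℝ),
    H = spectralMatrix V e := ⟨_, _, hH.exists_eq_spectralMatrix⟩
  obtain ⟨Z, hZ, hgibbs⟩ := gibbsState_spectralMatrix β V e
  rw [hV, hgibbs] at hRfix
  have hq : ∀ j, 0 < Real.exp (-β * e j) / Z := fun j => div_pos (Real.exp_pos _) hZ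
  have hdpi := spectralRelEntropy_map_le R hR hp hq hp' hq (by rw [← hU, hU']) hRfix
  -- The logarithm of the Gibbs state is affine in `H`. Both states have unit trace, so `log Z`
  -- cancels between the two relative entropies.
  have hlog : spectralMatrix V (fun j => Real.log (Real.exp (-β * e j) / Z)) =
      ((-β : ℝ) : ℂ) • H - ((Real.log Z : ℝ) : ℂ) • 1 := by
    rw [hV, smul_spectralMatrix, ← spectralMatrix_const V, sub_spectralMatrix]
    congr 1
    funext j
    rw [Real.log_div (Real.exp_pos _).ne' hZ.ne', Real.log_exp]
  rw [spectralRelEntropy_eq, spectralRelEntropy_eq, hlog, ← hU, ← hU'] at hdpi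
  simp only [Matrix.mul_sub, Matrix.mul_smul, Matrix.trace_sub, Matrix.trace_smul, Matrix.mul_one,
    hτ.2, hRτ.2, smul_eq_mul, Complex.sub_re, Complex.re_ofReal_mul] at hdpi
  have hS : vonNeumannEntropy τ = -∑ i, p i * Real.log (p i) := by
    rw [hU, vonNeumannEntropy_spectralMatrix]
  have hS' : vonNeumannEntropy (R τ) = -∑ i, p' i * Real.log (p' i) := by
    rw [hU', vonNeumannEntropy_spectralMatrix]
  rw [hS, hS']
  linarith

lemma abs_trace_mul_le {X K : QubitOp Λ} (hX : X.IsHermitian) (hK : K.IsHermitian) :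
    |(X * K).trace.re| ≤ traceNorm X * ‖K‖ := by
  have h := abs_trace_spectralMatrix_mul_le hX.eigenvectorUnitary hK.eigenvectorUnitary
    hX.eigenvalues hK.eigenvalues (abs_le_norm_spectralMatrix hK.eigenvectorUnitary _)
  rwa [← traceNorm_spectralMatrix hX.eigenvectorUnitary, ← hX.exists_eq_spectralMatrix,
    ← hK.exists_eq_spectralMatrix] at h

lemma IsQuantumState.traceNorm_eq_one {σ : QubitOp Λ} (hσ : IsQuantumState σ) :
    traceNorm σ = 1 := by
  obtain ⟨U, p, rfl, hp, hp1⟩ := hσ.exists_eq_spectralMatrix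
  rw [traceNorm_spectralMatrix, ← hp1]
  exact Finset.sum_congr rfl fun i _ => abs_of_nonneg (hp i)

lemma traceNorm_nonneg {X : QubitOp Λ} (hX : X.IsHermitian) : 0 ≤ traceNorm X := by
  rw [hX.exists_eq_spectralMatrix, traceNorm_spectralMatrix]
  exact Finset.sum_nonneg fun i _ => abs_nonneg _

lemma eq_zero_of_traceNorm_nonpos {X : QubitOp Λ} (hX : X.IsHermitian) (h : traceNorm X ≤ 0) :
    X = 0 := by
  rw [hX.exists_eq_spectralMatrix, traceNorm_spectralMatrix] at h
  have h0 := (Finset.sum_eq_zero_iff_of_nonneg fun i _ => abs_nonneg (hX.eigenvalues i)).mp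
    (h.antisymm (Finset.sum_nonneg fun i _ => abs_nonneg _))
  rw [hX.exists_eq_spectralMatrix, show hX.eigenvalues = fun _ => 0 from
    funext fun i => abs_eq_zero.mp (h0 i (Finset.mem_univ i)), spectralMatrix_const]
  simp

/-- **Fannes-type continuity bound** for the von Neumann entropy. -/
theorem vonNeumannEntropy_sub_le {ρ σ : QubitOp Λ} (hρ : IsQuantumState ρ)
    (hσ : IsQuantumState σ) {ε : ℝ} (hε : 0 < ε) (h : traceNorm (ρ - σ) ≤ ε) :
    vonNeumannEntropy ρ - vonNeumannEntropy σ ≤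
      ε / 2 * Real.log (2 ^ Fintype.card Λ * (1 + ε) / ε) + Real.log (1 + ε) := by
  have hΔ : (ρ - σ).IsHermitian := hρ.1.isHermitian.sub hσ.1.isHermitian
  obtain ⟨U, p, rfl, hp, hp1⟩ := hρ.exists_eq_spectralMatrix
  obtain ⟨V, s, rfl, hs, hs1⟩ := hσ.exists_eq_spectralMatrix
  have hspec := hΔ.exists_eq_spectralMatrix
  rw [hspec, traceNorm_spectralMatrix] at h
  have := entropy_sub_le_of_spectral hp hs hp1 hs1 hspec hε h
  rw [vonNeumannEntropy_spectralMatrix, vonNeumannEntropy_spectralMatrix]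
  simp only [Fintype.card_pi, Fintype.card_fin, Finset.prod_const, Finset.card_univ, Nat.cast_pow,
    Nat.cast_ofNat] at this
  linarith

lemma isHermitian_boundaryHamiltonian {Γ : Type*} [Fintype Γ] (A : Finset Λ) {h : Γ → QubitOp Λ}
    (h_herm : ∀ γ, (h γ).IsHermitian) : (boundaryHamiltonian A h).IsHermitian :=
  isSelfAdjoint_sum _ fun γ _ => h_herm γ

/-- In units of `ε * M` the budget is `1` for the energy, `3/2` for the dimension term and `1` for
`log (1 + ε)`: in total `7/2`, below `4`. -/
lemma fannes_error_le {ε M E : ℝ} {n : ℕ} (hε : 0 < ε) (hM1 : 1 ≤ M) (hlog : Real.log (1 / ε) ≤ M)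
    (hE : E ≤ M) (hn : (n : ℝ) ≤ M) :
    ε * E + (ε / 2 * Real.log (2 ^ n * (1 + ε) / ε) + Real.log (1 + ε)) ≤ 4 * ε * M := by
  have h2 : Real.log 2 ≤ 1 := by linarith [Real.log_two_lt_d9]
  have h1 : Real.log (1 + ε) ≤ ε := by
    linarith [Real.log_le_sub_one_of_pos (show 0 < 1 + ε by linarith)]
  -- Nothing forces `ε ≤ 1`; for larger `ε` the ratio is at most `2`.
  have hratio : Real.log ((1 + ε) / ε) ≤ 1 + M := by
    rcases le_total ε 1 with hle | hle
    · have : Real.log ((1 + ε) / ε) ≤ Real.log (2 * (1 / ε)) := by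
        refine Real.log_le_log (by positivity) ?_
        rw [mul_one_div]
        exact div_le_div_of_nonneg_right (by linarith) hε.le
      rw [Real.log_mul two_ne_zero (by positivity)] at this
      linarith
    · have : Real.log ((1 + ε) / ε) ≤ Real.log 2 := by
        refine Real.log_le_log (by positivity) ?_
        rw [div_le_iff₀ hε]
        linarith
      linarith
  have hsplit : Real.log (2 ^ n * (1 + ε) / ε) = n * Real.log 2 + Real.log ((1 + ε) / ε) := by
    rw [mul_div_assoc, Real.log_mul (by positivity) (by positivity), Real.log_pow]
  have hn2 : n * Real.log 2 ≤ M :=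
    (mul_le_of_le_one_right (Nat.cast_nonneg n) h2).trans hn
  have hL : Real.log (2 ^ n * (1 + ε) / ε) ≤ 3 * M := by
    rw [hsplit]
    linarith
  have a1 : ε / 2 * Real.log (2 ^ n * (1 + ε) / ε) ≤ ε / 2 * (3 * M) :=
    mul_le_mul_of_nonneg_left hL (by linarith)
  have a2 : ε * E ≤ ε * M := mul_le_mul_of_nonneg_left hE hε.le
  have a3 : ε * 1 ≤ ε * M := mul_le_mul_of_nonneg_left hM1 hε.le
  linarith

end GibbsStates

/-! ### The area law -/

theorem mainTheorem4 {n : ℕ} {Γ : Type*} [Fintype Γ]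
    (h : Γ → QubitOp (Fin n)) (h_herm : ∀ γ, (h γ).IsHermitian)
    (β : ℝ) (hβ : 0 ≤ β)
    (A : Finset (Fin n))
    (σ : QubitOp (Fin n)) (hσ : IsQuantumState σ)
    (R : QubitOp (Fin n) →CP QubitOp (Fin n)) (hR : IsTracePreserving R)
    (hRfix : R (gibbsState β (∑ γ, h γ)) = gibbsState β (∑ γ, h γ))
    (εMarkov : ℝ)
    (hrec : traceNorm (R (regionTensor A (marginal A σ) (marginal Aᶜ σ)) - σ) ≤ εMarkov) :
    mutualInformation A σ ≤
      2 * β * ‖boundaryHamiltonian A h‖ +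
        4 * εMarkov * max (Real.log (1 / εMarkov)) (max (β * ‖∑ γ, h γ‖) (n : ℝ)) := by
  set H := ∑ γ, h γ with hHdef
  set τ := regionTensor A (marginal A σ) (marginal Aᶜ σ) with hτdef
  have hHherm : H.IsHermitian := isSelfAdjoint_sum _ fun γ _ => h_herm γ
  have hBherm := isHermitian_boundaryHamiltonian A h_herm
  have hτ : IsQuantumState τ := isQuantumState_regionTensor (hσ.marginal A) (hσ.marginal Aᶜ)
  have hRτ : IsQuantumState (R τ) := ⟨hτ.1.map_completelyPositive R, (hR τ).trans hτ.2⟩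
  have hΔ : (R τ - σ).IsHermitian := hRτ.1.isHermitian.sub hσ.1.isHermitian
  have hI : mutualInformation A σ = vonNeumannEntropy τ - vonNeumannEntropy σ := by
    rw [mutualInformation, hτdef,
      vonNeumannEntropy_regionTensor (hσ.marginal A) (hσ.marginal Aᶜ)]
  have hfree := vonNeumannEntropy_sub_map_le hHherm β R hR hRfix hτ hRτ
  have hloc : (τ * H).trace.re - (σ * H).trace.re ≤ 2 * ‖boundaryHamiltonian A h‖ := by
    have hA : marginal A τ = marginal A σ := by
      rw [hτdef, marginal_regionTensor, (hσ.marginal Aᶜ).2, one_smul]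
    have hA' : marginal Aᶜ τ = marginal Aᶜ σ := by
      rw [hτdef, marginal_compl_regionTensor, (hσ.marginal A).2, one_smul]
    have hsub := congrArg Complex.re (trace_sum_mul_sub h hA hA')
    rw [Complex.sub_re, Complex.sub_re, ← hHdef, Matrix.trace_mul_comm H, Matrix.trace_mul_comm H,
      Matrix.trace_mul_comm _ τ, Matrix.trace_mul_comm _ σ] at hsub
    have b1 := abs_trace_mul_le hτ.1.isHermitian hBherm
    have b2 := abs_trace_mul_le hσ.1.isHermitian hBherm
    rw [hτ.traceNorm_eq_one, one_mul] at b1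
    rw [hσ.traceNorm_eq_one, one_mul] at b2
    linarith [(abs_le.mp b1).2, (abs_le.mp b2).1]
  have hloc' := mul_le_mul_of_nonneg_left hloc hβ
  have hε0 : 0 ≤ εMarkov := (traceNorm_nonneg hΔ).trans hrec
  set M := max (Real.log (1 / εMarkov)) (max (β * ‖H‖) (n : ℝ)) with hM
  have hnM : (n : ℝ) ≤ M := (le_max_right _ _).trans (le_max_right _ _)
  have hHM : β * ‖H‖ ≤ M := (le_max_left _ _).trans (le_max_right _ _)
  -- Exact recovery needs no continuity estimate. It absorbs `εMarkov = 0`, and also `n = 0`, where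
  -- there is only one state and `1 ≤ M` could fail.
  by_cases hdeg : R τ = σ
  · have hRHS : 0 ≤ 4 * εMarkov * M :=
      mul_nonneg (by linarith) ((Nat.cast_nonneg n).trans hnM)
    rw [hdeg] at hfree
    linarith
  have hε : 0 < εMarkov := by
    refine hε0.lt_of_ne fun h0 => hdeg ?_
    exact sub_eq_zero.mp (eq_zero_of_traceNorm_nonpos hΔ (h0 ▸ hrec))
  have hn : 1 ≤ n := by
    refine Nat.one_le_iff_ne_zero.mpr fun h0 => hdeg ?_
    subst h0
    ext x y
    have htr := hRτ.2.trans hσ.2.symm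
    rw [Matrix.trace, Matrix.trace, Fintype.sum_subsingleton _ x, Fintype.sum_subsingleton _ x] at htr
    rwa [Subsingleton.elim y x]
  have hM1 : 1 ≤ M := le_trans (by exact_mod_cast hn) hnM
  have hfannes := vonNeumannEntropy_sub_le hRτ hσ hε hrec
  rw [Fintype.card_fin] at hfannes
  have herr := fannes_error_le hε hM1 (le_max_left _ _) hHM hnM
  -- Imperfect recovery costs energy as well as entropy; this is the source of `β * ‖H‖` in the
  -- maximum.
  have henergy : (σ * H).trace.re - (R τ * H).trace.re ≤ εMarkov * ‖H‖ := by
    have b := (abs_le.mp (abs_trace_mul_le hΔ hHherm)).1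
    rw [Matrix.sub_mul, Matrix.trace_sub, Complex.sub_re] at b
    linarith [mul_le_mul_of_nonneg_right hrec (norm_nonneg H)]
  have henergy' := mul_le_mul_of_nonneg_left henergy hβ
  linarith
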